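/- Graphs are finite and undirected; parallel edges are allowed, and distinct parallel edges are counted separately. A \emph{linear arrangement} of a graph $G=(V,E)$ is a bijection $\pi:V\to\{1,\dots,|V|\}$; its cost is $COST_\pi(G)=\sum_{e\in E}|\pi(u_e)-\pi(v_e)|$, where $u_e,v_e$ are the ends of $e$, and it is \emph{optimal} if its cost is minimum. A \emph{two-terminal graph} is a graph with two distinct distinguished vertices, its source and its sink (its terminals). The \emph{series composition} of $X_1,\dots,X_k$ ($k\ge 2$) is obtained from their disjoint union by merging the sink of $X_i$ with the source of $X_{i+1}$ for $1\le i<k$; its source is that of $X_1$ and its sink that of $X_k$. The \emph{parallel composition} of $X_1,\dots,X_k$ ($k\ge 2$) is obtained from their disjoint union by merging all sources into the source and all sinks into the sink. A graph is \emph{series-parallel} if, for some choice of terminals, it can be built from single edges by series and parallel compositions. An \emph{SP-tree} of a series-parallel graph $G$ is a rooted tree whose nodes correspond to two-terminal subgraphs of $G$ such that the root corresponds to $G$, each leaf is an $L$-node corresponding to a path with $k\ge1$ edges between its terminals, and each inner node is an $S$-node (or $P$-node) whose subgraph is the series (or parallel) composition of the subgraphs of its at least two children, taken in order. It is \emph{minimal}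 if every child of an $S$-node is a $P$-node or an $L$-node and at least one is a $P$-node, and every child of a $P$-node is an $S$-node or an $L$-node. Let $G$ be a series-parallel graph with a fixed minimal SP-tree $T$. The subgraphs corresponding to the $L$-nodes are the \emph{simple node sequences} of $G$, those of the $P$-nodes are the \emph{parallel components}, and those of the $S$-nodes and of the $L$-nodes are the \emph{series components}; denote these three families by $L_G$, $P_G$, $S_G$. Write $C_i\in C$ if the node of $C_i$ is a child of the node of $C$ in $T$. For a component $C$ let $|C|$ be its number of vertices, $|C^\ominus|$ the number of its vertices other than its sink, and $|C^-|$ the number of its vertices other than its two terminals. \textbf{Statement.} For every series-parallel graph $G$, every minimal SP-tree $T$ of $G$ and every optimal linear arrangement $\pi_{OPT}$ of $G$, $$7\cdot COST_{\pi_{OPT}}(G)\ \ge\ \sum_{L\in L_G}2(|L|-1)+\sum_{P\in P_G}\Bigl(\sum_{S_i\in P}|S_i^-|-\max_{S_i\in P}|S_i^-|\Bigr)+\sum_{S\in S_G}\Bigl(\sum_{P_i\in S}|P_i^\ominus|-\max_{P_i\in S}|P_i^\ominus|\Bigr),$$ where the sum and the maximum over the empty family of children of an $L$-node are $0$. -/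

import Mathlib

/-! Graphs are Mathlib's undirected multigraphs `Graph α β` (vertices in `α`, edges in `β`): a parallel
composition is formed from a disjoint union, so it may create several edges with the same two ends.
A simple graph is the special case in which no two edges have the same ends. -/

namespace SeriesParallel

variable {α β : Type*}

/-! ### Linear arrangements and their cost -/

open Classical in
/-- The length `|π x - π y|` of the edge `e` of `G` with ends `x`, `y` (and `0` if `e` is not an edge
of `G`); see `edgeLength_eq` for independence of the chosen order of the ends. -/
noncomputable def edgeLength (G : Graph α β) (π : α → ℕ) (e : β) : ℤ :=
  if h : ∃ x y, G.IsLink e x y then |(π h.choose : ℤ) - π h.choose_spec.choose| else 0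

theorem edgeLength_eq {G : Graph α β} {e : β} {x y : α} (h : G.IsLink e x y) (π : α → ℕ) :
    edgeLength G π e = |(π x : ℤ) - π y| := by
  have h' : ∃ x y, G.IsLink e x y := ⟨x, y, h⟩
  rw [edgeLength, dif_pos h']
  rcases h'.choose_spec.choose_spec.eq_and_eq_or_eq_and_eq h with ⟨h1, h2⟩ | ⟨h1, h2⟩
  · rw [h2, h1]
  · rw [h2, h1, abs_sub_comm]

/-- The cost of `π` on `G`: the sum of the lengths of all edges. -/
noncomputable def cost (G : Graph α β) (π : α → ℕ) : ℤ :=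
  ∑ᶠ e ∈ G.edgeSet, edgeLength G π e

/-- `π` maps the vertices of `G` one-to-one onto `{1, …, n}`, where `n` is the number of vertices. -/
def IsLinearArrangement (G : Graph α β) (π : α → ℕ) : Prop :=
  Set.BijOn π G.vertexSet (Set.Icc 1 G.vertexSet.ncard)

/-- `π` is a linear arrangement of `G` of minimum cost. -/
def IsOptimalArrangement (G : Graph α β) (π : α → ℕ) : Prop :=
  IsLinearArrangement G π ∧ ∀ σ : α → ℕ, IsLinearArrangement G σ → cost G π ≤ cost G σ

/-! ### Two-terminal graphs, series and parallel composition -/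

/-- A graph with two distinct distinguished vertices, its terminals. -/
structure TwoTerminalGraph (α β : Type*) extends Graph α β where
  source : α
  sink : α
  source_mem : source ∈ toGraph.vertexSet
  sink_mem : sink ∈ toGraph.vertexSet
  source_ne_sink : source ≠ sink

/-- `Y` is, as a graph, the union of the graphs `X i`, and these have pairwise disjoint edge sets. -/
structure IsEdgeDisjointUnion {n : ℕ} (X : Fin n → TwoTerminalGraph α β)
    (Y : TwoTerminalGraph α β) : Prop where
  vertexSet_eq : Y.vertexSet = ⋃ i, (X i).vertexSet
  isLink_iff : ∀ e x y, Y.IsLink e x y ↔ ∃ i, (X i).IsLink e x y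
  disjoint_edgeSet : ∀ i j, i ≠ j → Disjoint (X i).edgeSet (X j).edgeSet

/-- `Y` is the series composition of `X 0, …, X (n - 1)`, `n ≥ 2`: it is their union, the only
identified vertices being the sink of each graph with the source of the next one. -/
structure IsSeriesComposition {n : ℕ} (X : Fin n → TwoTerminalGraph α β)
    (Y : TwoTerminalGraph α β) : Prop where
  two_le : 2 ≤ n
  isUnion : IsEdgeDisjointUnion X Y
  sink_eq_source : ∀ i j : Fin n, (i : ℕ) + 1 = j → (X i).sink = (X j).source
  inter_eq : ∀ i j : Fin n, (i : ℕ) + 1 = j →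
    (X i).vertexSet ∩ (X j).vertexSet = {(X i).sink}
  disjoint : ∀ i j : Fin n, (i : ℕ) + 1 < j → Disjoint (X i).vertexSet (X j).vertexSet
  source_eq : ∀ i : Fin n, (i : ℕ) = 0 → Y.source = (X i).source
  sink_eq : ∀ i : Fin n, (i : ℕ) + 1 = n → Y.sink = (X i).sink

/-- `Y` is the parallel composition of the `n ≥ 2` graphs `X i`: it is their union, the only
identified vertices being all the sources and all the sinks. -/
structure IsParallelComposition {n : ℕ} (X : Fin n → TwoTerminalGraph α β)
    (Y : TwoTerminalGraph α β) : Prop where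
  two_le : 2 ≤ n
  isUnion : IsEdgeDisjointUnion X Y
  source_eq : ∀ i, (X i).source = Y.source
  sink_eq : ∀ i, (X i).sink = Y.sink
  inter_eq : ∀ i j, i ≠ j → (X i).vertexSet ∩ (X j).vertexSet = {Y.source, Y.sink}

/-- Two-terminal series-parallel graphs: those built from single edges by series and parallel
compositions. (`Graph.banana s t {e}` is the graph with vertices `s`, `t` and the one edge `e`.) -/
inductive IsTTSP : TwoTerminalGraph α β → Prop
  | edge (X : TwoTerminalGraph α β) (e : β) (h : X.toGraph = Graph.banana X.source X.sink {e}) :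
      IsTTSP X
  | series {n : ℕ} (X : Fin n → TwoTerminalGraph α β) (Y : TwoTerminalGraph α β)
      (hX : ∀ i, IsTTSP (X i)) (h : IsSeriesComposition X Y) : IsTTSP Y
  | parallel {n : ℕ} (X : Fin n → TwoTerminalGraph α β) (Y : TwoTerminalGraph α β)
      (hX : ∀ i, IsTTSP (X i)) (h : IsParallelComposition X Y) : IsTTSP Y

/-- `G` is a series-parallel graph: for some choice of two terminals it is a two-terminal
series-parallel graph. -/
def IsSeriesParallel (G : Graph α β) : Prop :=
  ∃ X : TwoTerminalGraph α β, X.toGraph = G ∧ IsTTSP X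

/-- `X` is a path with `k` edges from its source to its sink: the vertices are the distinct
`v 0, …, v k`, the edges are the distinct `e 0, …, e (k - 1)`, and `e i` joins `v i` to `v (i + 1)`.
As the terminals are distinct, `k ≥ 1`. -/
def IsPathGraph (k : ℕ) (X : TwoTerminalGraph α β) : Prop :=
  ∃ (v : Fin (k + 1) → α) (e : Fin k → β), Function.Injective v ∧ Function.Injective e ∧
    X.vertexSet = Set.range v ∧ X.source = v 0 ∧ X.sink = v (Fin.last k) ∧
    ∀ f x y, X.IsLink f x y ↔ ∃ i : Fin k, f = e i ∧ s(x, y) = s(v i.castSucc, v i.succ)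

/-! ### SP-trees and components -/

/-- Rooted ordered trees with leaves labelled `L(k)` and inner nodes labelled `S` or `P`, in which
every node carries a two-terminal graph. -/
inductive SPTree (α β : Type*)
  | L (k : ℕ) (X : TwoTerminalGraph α β)
  | S (X : TwoTerminalGraph α β) {n : ℕ} (child : Fin n → SPTree α β)
  | P (X : TwoTerminalGraph α β) {n : ℕ} (child : Fin n → SPTree α β)

namespace SPTree

/-- The two-terminal graph associated with the root (the component, for a subtree of an SP-tree). -/
def graph : SPTree α β → TwoTerminalGraph α β
  | L _ X => X
  | S X _ => X
  | P X _ => X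

def IsLNode : SPTree α β → Prop
  | L _ _ => True
  | _ => False

def IsSNode : SPTree α β → Prop
  | S _ _ => True
  | _ => False

def IsPNode : SPTree α β → Prop
  | P _ _ => True
  | _ => False

/-- The graphs at the nodes fit together: `L(k)` carries a path with `k` edges, and an `S`-node
(`P`-node) carries the series (parallel) composition of the graphs of its children. -/
def IsConsistent : SPTree α β → Prop
  | L k X => IsPathGraph k X
  | S X child => IsSeriesComposition (fun i => (child i).graph) X ∧ ∀ i, (child i).IsConsistent
  | P X child => IsParallelComposition (fun i => (child i).graph) X ∧ ∀ i, (child i).IsConsistent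

/-- `T` is an SP-tree of `G`. -/
def IsSPTreeOf (T : SPTree α β) (G : Graph α β) : Prop :=
  T.IsConsistent ∧ T.graph.toGraph = G

/-- All children of an `S`-node are `P`- or `L`-nodes, at least one of them a `P`-node, and all
children of a `P`-node are `S`- or `L`-nodes. -/
def IsMinimal : SPTree α β → Prop
  | L _ _ => True
  | S _ child => (∀ i, (child i).IsPNode ∨ (child i).IsLNode) ∧ (∃ i, (child i).IsPNode) ∧
      ∀ i, (child i).IsMinimal
  | P _ child => (∀ i, (child i).IsSNode ∨ (child i).IsLNode) ∧ ∀ i, (child i).IsMinimal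

/-- The children of the root (the child components). -/
def children : SPTree α β → Multiset (SPTree α β)
  | L _ _ => 0
  | S _ child => Finset.univ.val.map child
  | P _ child => Finset.univ.val.map child

/-- All nodes of the tree, each one given as the subtree below it: the components. -/
def nodes : SPTree α β → Multiset (SPTree α β)
  | L k X => {L k X}
  | S X child => S X child ::ₘ ∑ i, (child i).nodes
  | P X child => P X child ::ₘ ∑ i, (child i).nodes

open Classical in
/-- The simple node sequences (the leaves). -/
noncomputable def simpleNodeSequences (T : SPTree α β) : Multiset (SPTree α β) :=
  T.nodes.filter IsLNode

open Classical in
/-- The parallel components (the `P`-nodes). -/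
noncomputable def parallelComponents (T : SPTree α β) : Multiset (SPTree α β) :=
  T.nodes.filter IsPNode

open Classical in
/-- The series components: the `S`-nodes and also the leaves, as every simple node sequence counts as
a series component (one without child components). -/
noncomputable def seriesComponents (T : SPTree α β) : Multiset (SPTree α β) :=
  T.nodes.filter fun C => C.IsSNode ∨ C.IsLNode

/-- `|C|`: the number of vertices of the component. -/
noncomputable def card (C : SPTree α β) : ℕ :=
  C.graph.vertexSet.ncard

/-- `|C^⊖|`: the number of vertices of the component other than its sink. -/
noncomputable def cardNoSink (C : SPTree α β) : ℕ :=
  (C.graph.vertexSet \ {C.graph.sink}).ncard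

/-- `|C^-|`: the number of vertices of the component other than its two terminals. -/
noncomputable def cardNoTerminals (C : SPTree α β) : ℕ :=
  (C.graph.vertexSet \ {C.graph.source, C.graph.sink}).ncard

/-- The sum minus the maximum of the numbers `size D` over the children `D` of the root of `C`
(`0` if there are no children). -/
noncomputable def sumSubMax (size : SPTree α β → ℕ) (C : SPTree α β) : ℤ :=
  ((C.children.map size).sum : ℤ) - ((C.children.map size).sup : ℤ)

end SPTree

end SeriesParallel

/-! An edge of length `l` passes over `l - 1` positions, so the cost of an arrangement dominates the
number of edges plus the number of pairs (vertex, edge passing over it). This quantity, `rankCost`,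
depends only on the order of the vertices, so it restricts to subgraphs without renumbering. In a
composition the parts keep their own crossings, and every vertex passed by an edge of a part not
containing it supplies a new one (`IsEdgeDisjointUnion.rankCost_ge`). The lower bound is then proved
by induction on the SP-tree, each node being paid for by these new crossings.

The inner vertices of a component are split into left, right and middle ones, according to their
position relative to its two terminals. Let `c` be the number of crossed vertices of a composition.
Parts are connected, so an uncrossed left vertex of one part precedes all other parts. Hence a
single part contains all uncrossed left vertices, and likewise a single part all uncrossed right
ones. If these parts coincide, the subtracted maximum absorbs both groups. Otherwise only one group
is absorbed, and the other must be paid for by the children; this is why the induction carries the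
extra term `max left right`.

Middle vertices of a part are crossed in a parallel composition, since every other part joins the
same terminals. In a series composition they need not be, so the children of an `S`-node must
provide `2 * mid` in addition. They can: by minimality they are `P`- or `L`-nodes, for which the
stronger inequality holds. The additive constant 2 per child pays for the merged terminals of a
series composition. The crossing coefficients are 2 for series and 6 for parallel compositions, both
within the factor 7. -/

namespace SeriesParallel

variable {α β : Type*}

/-! ### Connectedness -/

/-- Every set of vertices that is closed under adjacency and contains a vertex contains all. -/
def IsConnected (G : Graph α β) : Prop :=
  ∀ A : Set α, (∀ e x y, G.IsLink e x y → x ∈ A → y ∈ A) →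
    ∀ u ∈ G.vertexSet, u ∈ A → ∀ w ∈ G.vertexSet, w ∈ A

/-- Adjacency is symmetric, so the complement of a closed set is closed; if it contained the source,
it would contain every vertex. -/
theorem isConnected_of_forall_source {X : TwoTerminalGraph α β}
    (h : ∀ A : Set α, (∀ e x y, X.IsLink e x y → x ∈ A → y ∈ A) →
      X.source ∈ A → ∀ w ∈ X.vertexSet, w ∈ A) : IsConnected X.toGraph := by
  intro A hA u hu huA w hw
  by_cases hs : X.source ∈ A
  · exact h A hA hs w hw
  · exact absurd huA (h Aᶜ (fun e x y hl hx hy => hx (hA e y x hl.symm hy)) hs u hu)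

theorem IsPathGraph.isConnected {k : ℕ} {X : TwoTerminalGraph α β} (h : IsPathGraph k X) :
    IsConnected X.toGraph := by
  obtain ⟨v, e, -, -, hV, hs, -, hl⟩ := h
  apply isConnected_of_forall_source
  intro A hA hsA w hw
  rw [hV] at hw
  obtain ⟨i, rfl⟩ := hw
  induction i using Fin.induction with
  | zero => exact hs ▸ hsA
  | succ i ih => exact hA (e i) _ _ ((hl _ _ _).2 ⟨i, rfl, rfl⟩) ih

theorem IsEdgeDisjointUnion.isLink {n : ℕ} {X : Fin n → TwoTerminalGraph α β}
    {Y : TwoTerminalGraph α β} (h : IsEdgeDisjointUnion X Y) {i : Fin n} {e : β} {x y : α}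
    (hl : (X i).IsLink e x y) : Y.IsLink e x y :=
  (h.isLink_iff e x y).2 ⟨i, hl⟩

theorem IsEdgeDisjointUnion.mem_vertexSet {n : ℕ} {X : Fin n → TwoTerminalGraph α β}
    {Y : TwoTerminalGraph α β} (h : IsEdgeDisjointUnion X Y) {i : Fin n} {v : α}
    (hv : v ∈ (X i).vertexSet) : v ∈ Y.vertexSet := by
  rw [h.vertexSet_eq]
  exact Set.mem_iUnion.2 ⟨i, hv⟩

theorem IsEdgeDisjointUnion.edgeSet_eq {n : ℕ} {X : Fin n → TwoTerminalGraph α β}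
    {Y : TwoTerminalGraph α β} (h : IsEdgeDisjointUnion X Y) :
    Y.edgeSet = ⋃ i, (X i).edgeSet := by
  ext e
  simp only [Set.mem_iUnion, Graph.edge_mem_iff_exists_isLink, h.isLink_iff]
  grind

theorem IsSeriesComposition.isConnected {n : ℕ} {X : Fin n → TwoTerminalGraph α β}
    {Y : TwoTerminalGraph α β} (h : IsSeriesComposition X Y)
    (hX : ∀ i, IsConnected (X i).toGraph) : IsConnected Y.toGraph := by
  apply isConnected_of_forall_source
  intro A hA hs w hw
  have key : ∀ i : ℕ, ∀ hi : i < n, (X ⟨i, hi⟩).source ∈ A := by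
    intro i
    induction i with
    | zero => intro hi; rw [← h.source_eq ⟨0, hi⟩ rfl]; exact hs
    | succ i ih =>
      intro hi
      rw [← h.sink_eq_source ⟨i, by omega⟩ ⟨i + 1, hi⟩ rfl]
      exact hX _ A (fun e x y hl => hA e x y (h.isUnion.isLink hl)) _ (X _).source_mem
        (ih (by omega)) _ (X _).sink_mem
  rw [h.isUnion.vertexSet_eq] at hw
  obtain ⟨i, hi⟩ := Set.mem_iUnion.1 hw
  exact hX i A (fun e x y hl => hA e x y (h.isUnion.isLink hl)) _ (X _).source_mem
    (key i i.2) _ hi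

theorem IsParallelComposition.isConnected {n : ℕ} {X : Fin n → TwoTerminalGraph α β}
    {Y : TwoTerminalGraph α β} (h : IsParallelComposition X Y)
    (hX : ∀ i, IsConnected (X i).toGraph) : IsConnected Y.toGraph := by
  apply isConnected_of_forall_source
  intro A hA hs w hw
  rw [h.isUnion.vertexSet_eq] at hw
  obtain ⟨i, hi⟩ := Set.mem_iUnion.1 hw
  exact hX i A (fun e x y hl => hA e x y (h.isUnion.isLink hl)) _ (X _).source_mem
    (by rw [h.source_eq]; exact hs) _ hi

/-- Finite, connected and without loops. -/
structure IsNice (G : Graph α β) : Prop where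
  finite_vertexSet : G.vertexSet.Finite
  finite_edgeSet : G.edgeSet.Finite
  isConnected : IsConnected G
  ne_of_isLink : ∀ e x y, G.IsLink e x y → x ≠ y

theorem IsPathGraph.edgeSet_eq {k : ℕ} {X : TwoTerminalGraph α β} (h : IsPathGraph k X) :
    X.edgeSet.ncard = k ∧ X.edgeSet.Finite := by
  obtain ⟨v, e, -, he, -, -, -, hl⟩ := h
  have : X.edgeSet = Set.range e := by
    ext f
    simp only [Graph.edge_mem_iff_exists_isLink, hl, Set.mem_range]
    constructor
    · rintro ⟨x, y, i, rfl, -⟩; exact ⟨i, rfl⟩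
    · rintro ⟨i, rfl⟩; exact ⟨_, _, i, rfl, rfl⟩
  rw [this, Set.ncard_range_of_injective he]
  exact ⟨by simp, Set.finite_range e⟩

theorem IsPathGraph.vertexSet_ncard {k : ℕ} {X : TwoTerminalGraph α β} (h : IsPathGraph k X) :
    X.vertexSet.ncard = k + 1 := by
  obtain ⟨v, e, hv, -, hV, -⟩ := h
  rw [hV, Set.ncard_range_of_injective hv]
  simp

theorem IsPathGraph.isNice {k : ℕ} {X : TwoTerminalGraph α β} (h : IsPathGraph k X) :
    IsNice X.toGraph := by
  refine ⟨?_, h.edgeSet_eq.2, h.isConnected, ?_⟩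
  · obtain ⟨v, e, -, -, hV, -⟩ := h
    rw [hV]; exact Set.finite_range v
  · obtain ⟨v, e, hv, -, -, -, -, hl⟩ := h
    rintro f x y hf rfl
    obtain ⟨i, -, hi⟩ := (hl _ _ _).1 hf
    have h1 : v i.castSucc = v i.succ := by
      rcases Sym2.eq_iff.1 hi with ⟨a, b⟩ | ⟨a, b⟩
      · exact a.symm.trans b
      · exact b.symm.trans a
    have := congrArg Fin.val (hv h1)
    simp at this

theorem IsEdgeDisjointUnion.isNice {n : ℕ} {X : Fin n → TwoTerminalGraph α β}
    {Y : TwoTerminalGraph α β} (h : IsEdgeDisjointUnion X Y)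
    (hX : ∀ i, IsNice (X i).toGraph) (hY : IsConnected Y.toGraph) : IsNice Y.toGraph where
  finite_vertexSet := by
    rw [h.vertexSet_eq]; exact Set.finite_iUnion fun i => (hX i).finite_vertexSet
  finite_edgeSet := by
    rw [h.edgeSet_eq]; exact Set.finite_iUnion fun i => (hX i).finite_edgeSet
  isConnected := hY
  ne_of_isLink e x y hl := by
    obtain ⟨i, hi⟩ := (h.isLink_iff e x y).1 hl
    exact (hX i).ne_of_isLink e x y hi

theorem SPTree.IsConsistent.isNice {T : SPTree α β} (hT : T.IsConsistent) :
    IsNice T.graph.toGraph := by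
  induction T with
  | L k X => exact IsPathGraph.isNice hT
  | S X child ih =>
    obtain ⟨h, hc⟩ := hT
    have := fun i => ih i (hc i)
    exact h.isUnion.isNice this (h.isConnected fun i => (this i).isConnected)
  | P X child ih =>
    obtain ⟨h, hc⟩ := hT
    have := fun i => ih i (hc i)
    exact h.isUnion.isNice this (h.isConnected fun i => (this i).isConnected)

/-! ### Vertices passed by edges -/

/-- Some edge of `G` passes over the position of `v`. -/
def Crosses (f : α → ℤ) (G : Graph α β) (v : α) : Prop :=
  ∃ e x y, G.IsLink e x y ∧ f x < f v ∧ f v < f y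

theorem crosses_neg {f : α → ℤ} {G : Graph α β} {v : α} :
    Crosses (-f) G v ↔ Crosses f G v := by
  constructor
  · rintro ⟨e, x, y, h, h1, h2⟩
    exact ⟨e, y, x, h.symm, by simpa using h2, by simpa using h1⟩
  · rintro ⟨e, x, y, h, h1, h2⟩
    exact ⟨e, y, x, h.symm, by simpa using h2, by simpa using h1⟩

/-- Some edge leaves the set of vertices before `v`, and it must jump over `v` because no vertex of
`G` shares the position of `v`. -/
theorem IsConnected.crosses {f : α → ℤ} {G : Graph α β} (hG : IsConnected G) {u v w : α}
    (hne : ∀ x ∈ G.vertexSet, f x ≠ f v) (hu : u ∈ G.vertexSet) (hw : w ∈ G.vertexSet)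
    (huv : f u < f v) (hvw : f v < f w) : Crosses f G v := by
  by_contra hc
  have := hG {x | f x < f v} (fun e x y hl hx => ?_) u hu huv w hw
  · exact absurd this (not_lt.2 hvw.le)
  · have h1 : ¬ f v < f y := fun h => hc ⟨e, x, y, hl, hx, h⟩
    exact lt_of_le_of_ne (not_lt.1 h1) (hne y hl.right_mem)

/-- The pairs of a vertex and an edge of `G` passing over it. -/
def crossings (f : α → ℤ) (G : Graph α β) : Set (α × β) :=
  {p | p.1 ∈ G.vertexSet ∧ ∃ x y, G.IsLink p.2 x y ∧ f x < f p.1 ∧ f p.1 < f y}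

theorem crossings_subset (f : α → ℤ) (G : Graph α β) :
    crossings f G ⊆ G.vertexSet ×ˢ G.edgeSet := by
  rintro ⟨v, e⟩ ⟨hv, x, y, hl, -⟩
  exact ⟨hv, hl.edge_mem⟩

/-- The number of edges plus the number of crossings: the cost of the ranks of `f` on the vertices. -/
noncomputable def rankCost (f : α → ℤ) (G : Graph α β) : ℕ :=
  G.edgeSet.ncard + (crossings f G).ncard

/-- The vertices of `Y` passed by an edge of some `X i` to which they do not belong. -/
def crossed {n : ℕ} (f : α → ℤ) (X : Fin n → TwoTerminalGraph α β) (Y : TwoTerminalGraph α β) :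
    Set α :=
  {v | v ∈ Y.vertexSet ∧ ∃ i, v ∉ (X i).vertexSet ∧ Crosses f (X i).toGraph v}

theorem crossed_neg {n : ℕ} (f : α → ℤ) (X : Fin n → TwoTerminalGraph α β)
    (Y : TwoTerminalGraph α β) : crossed (-f) X Y = crossed f X Y := by
  simp only [crossed, crosses_neg]

/-- An edge determines its part, so crossings inside different parts are distinct. One chosen
crossing per crossed vertex is new, as the vertex is foreign to the part of the edge. -/
theorem IsEdgeDisjointUnion.rankCost_ge {n : ℕ} {X : Fin n → TwoTerminalGraph α β}
    {Y : TwoTerminalGraph α β} (h : IsEdgeDisjointUnion X Y) (hY : IsNice Y.toGraph)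
    (hX : ∀ i, IsNice (X i).toGraph) (f : α → ℤ) :
    (∑ i, rankCost f (X i).toGraph) + (crossed f X Y).ncard ≤ rankCost f Y.toGraph := by
  have hfin : ∀ i, (crossings f (X i).toGraph).Finite := fun i =>
    (((hX i).finite_vertexSet).prod (hX i).finite_edgeSet).subset (crossings_subset _ _)
  have hfinY : (crossings f Y.toGraph).Finite :=
    (hY.finite_vertexSet.prod hY.finite_edgeSet).subset (crossings_subset _ _)
  have huniq : ∀ e i j, e ∈ (X i).edgeSet → e ∈ (X j).edgeSet → i = j := by
    intro e i j hi hj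
    by_contra hij
    exact Set.disjoint_left.1 (h.disjoint_edgeSet i j hij) hi hj
  have hE : Y.edgeSet.ncard = ∑ i, (X i).edgeSet.ncard := by
    rw [h.edgeSet_eq, Set.ncard_iUnion_of_finite (fun i => (hX i).finite_edgeSet)
      (fun i j hij => h.disjoint_edgeSet i j hij), finsum_eq_sum_of_fintype]
  have hC : (⋃ i, crossings f (X i).toGraph).ncard = ∑ i, (crossings f (X i).toGraph).ncard := by
    rw [Set.ncard_iUnion_of_finite hfin, finsum_eq_sum_of_fintype]
    intro i j hij
    refine Set.disjoint_left.2 fun p hi hj => hij ?_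
    exact huniq p.2 i j (crossings_subset _ _ hi).2 (crossings_subset _ _ hj).2
  have hch : ∀ v : crossed f X Y, ∃ e : β, ∃ i x y, (v : α) ∉ (X i).vertexSet ∧
      (X i).IsLink e x y ∧ f x < f v ∧ f v < f y := by
    rintro ⟨v, hv, i, hvi, e, x, y, hl⟩
    exact ⟨e, i, x, y, hvi, hl⟩
  choose g hg using hch
  let D : Set (α × β) := Set.range fun v : crossed f X Y => ((v : α), g v)
  have hD : D.ncard = (crossed f X Y).ncard := by
    rw [Set.ncard_range_of_injective, Nat.card_coe_set_eq]
    intro v w hvw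
    exact Subtype.ext (Prod.ext_iff.1 hvw).1
  have hdisj : Disjoint (⋃ i, crossings f (X i).toGraph) D := by
    refine Set.disjoint_left.2 ?_
    rintro p hp ⟨v, rfl⟩
    obtain ⟨i, hi⟩ := Set.mem_iUnion.1 hp
    obtain ⟨j, x, y, hv, hl, -⟩ := hg v
    have := huniq _ i j (crossings_subset _ _ hi).2 hl.edge_mem
    subst this
    exact hv hi.1
  have hsub : (⋃ i, crossings f (X i).toGraph) ∪ D ⊆ crossings f Y.toGraph := by
    apply Set.union_subset
    · refine Set.iUnion_subset fun i => ?_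
      rintro p ⟨hp, x, y, hl, hxy⟩
      exact ⟨h.mem_vertexSet hp, x, y, h.isLink hl, hxy⟩
    · rintro _ ⟨v, rfl⟩
      obtain ⟨j, x, y, hv, hl, hxy⟩ := hg v
      exact ⟨v.2.1, x, y, h.isLink hl, hxy⟩
  have h1 := Set.ncard_le_ncard hsub hfinY
  rw [Set.ncard_union_eq hdisj (hfinY.subset (Set.subset_union_left.trans hsub))
    (hfinY.subset (Set.subset_union_right.trans hsub)), hC, hD] at h1
  simp only [rankCost, Finset.sum_add_distrib, hE]
  omega

/-- By injectivity at most one vertex occupies each position strictly between the ends of an edge;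
the remaining unit of length accounts for the edge itself. -/
theorem IsNice.rankCost_le_cost {G : Graph α β} (hG : IsNice G) {π : α → ℕ}
    (hπ : Set.InjOn π G.vertexSet) : (rankCost (fun v => (π v : ℤ)) G : ℤ) ≤ cost G π := by
  classical
  set f : α → ℤ := fun v => (π v : ℤ) with hf
  have hinj : Set.InjOn f G.vertexSet := fun x hx y hy h => hπ hx hy (by simpa [hf] using h)
  let F : β → Set (α × β) := fun e => {p | p ∈ crossings f G ∧ p.2 = e}
  have hfin : (crossings f G).Finite :=
    (hG.finite_vertexSet.prod hG.finite_edgeSet).subset (crossings_subset _ _)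
  have hE : (crossings f G).ncard = ∑ e ∈ hG.finite_edgeSet.toFinset, (F e).ncard := by
    have : crossings f G = ⋃ e ∈ G.edgeSet, F e := by
      ext p
      simp only [Set.mem_iUnion, F, Set.mem_ofPred_eq]
      constructor
      · intro hp; exact ⟨p.2, (crossings_subset _ _ hp).2, hp, rfl⟩
      · rintro ⟨e, -, hp, -⟩; exact hp
    conv_lhs => rw [this]
    rw [hG.finite_edgeSet.ncard_biUnion (fun e _ => hfin.subset fun p hp => hp.1),
      finsum_mem_eq_finite_toFinset_sum _ hG.finite_edgeSet]
    intro e _ e' _ hee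
    exact Set.disjoint_left.2 fun p hp hp' => hee (hp.2.symm.trans hp'.2)
  have key : ∀ e ∈ G.edgeSet, 1 + ((F e).ncard : ℤ) ≤ edgeLength G π e := by
    intro e he
    obtain ⟨x, y, hl⟩ := (G.edge_mem_iff_exists_isLink e).1 he
    wlog hxy : f x ≤ f y generalizing x y
    · exact this y x hl.symm (le_of_not_ge hxy)
    have hlt : f x < f y := lt_of_le_of_ne hxy fun h =>
      hG.ne_of_isLink e x y hl (hinj hl.left_mem hl.right_mem h)
    rw [edgeLength_eq hl]
    have hsub : Set.MapsTo (fun p : α × β => f p.1) (F e) (Finset.Ioo (f x) (f y) : Set ℤ) := by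
      rintro ⟨v, e'⟩ ⟨⟨hv, x', y', hl', h1, h2⟩, rfl⟩
      simp only [Finset.coe_Ioo, Set.mem_Ioo]
      rcases hl.eq_and_eq_or_eq_and_eq hl' with ⟨rfl, rfl⟩ | ⟨rfl, rfl⟩
      · exact ⟨h1, h2⟩
      · exact absurd (h1.trans h2) (not_lt.2 hxy)
    have hc : (F e).ncard ≤ (Finset.Ioo (f x) (f y) : Set ℤ).ncard := by
      refine Set.ncard_le_ncard_of_injOn (fun p : α × β => f p.1) hsub ?_ (Finset.finite_toSet _)
      rintro ⟨v, e'⟩ ⟨hv, rfl⟩ ⟨w, e''⟩ ⟨hw, hw'⟩ hvw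
      have h1 : v = w := hinj hv.1 hw.1 hvw
      simp only [Prod.mk.injEq]
      exact ⟨h1, hw'.symm⟩
    rw [Set.ncard_coe_finset, Int.card_Ioo] at hc
    have : |(π x : ℤ) - π y| = f y - f x := by
      rw [abs_sub_comm]; exact abs_of_nonneg (by simp only [hf] at hlt ⊢; omega)
    omega
  rw [rankCost, cost, finsum_mem_eq_finite_toFinset_sum _ hG.finite_edgeSet, hE,
    Set.ncard_eq_toFinset_card _ hG.finite_edgeSet]
  push_cast
  rw [Finset.card_eq_sum_ones, Nat.cast_sum, ← Finset.sum_add_distrib]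
  refine Finset.sum_le_sum fun e he => ?_
  simpa using key e (by simpa using he)

/-! ### Positions of vertices relative to the terminals -/

namespace TwoTerminalGraph

/-- The vertices other than the terminals. -/
def inner (X : TwoTerminalGraph α β) : Set α := X.vertexSet \ {X.source, X.sink}

/-- The inner vertices placed before both terminals. -/
def leftInner (f : α → ℤ) (X : TwoTerminalGraph α β) : Set α :=
  {v | v ∈ X.inner ∧ f v < f X.source ∧ f v < f X.sink}

/-- The inner vertices placed after both terminals. -/
def rightInner (f : α → ℤ) (X : TwoTerminalGraph α β) : Set α :=
  {v | v ∈ X.inner ∧ f X.source < f v ∧ f X.sink < f v}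

/-- The remaining inner vertices. -/
def midInner (f : α → ℤ) (X : TwoTerminalGraph α β) : Set α :=
  {v | v ∈ X.inner ∧ v ∉ X.leftInner f ∧ v ∉ X.rightInner f}

theorem leftInner_neg (f : α → ℤ) (X : TwoTerminalGraph α β) :
    X.leftInner (-f) = X.rightInner f := by
  ext v; simp [leftInner, rightInner]

theorem rightInner_neg (f : α → ℤ) (X : TwoTerminalGraph α β) :
    X.rightInner (-f) = X.leftInner f := by
  ext v; simp [leftInner, rightInner]

theorem midInner_neg (f : α → ℤ) (X : TwoTerminalGraph α β) :
    X.midInner (-f) = X.midInner f := by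
  ext v; simp only [midInner, leftInner_neg, rightInner_neg]; grind

theorem ncard_inner (f : α → ℤ) {X : TwoTerminalGraph α β} (hX : X.vertexSet.Finite) :
    X.inner.ncard = (X.midInner f).ncard + (X.leftInner f).ncard + (X.rightInner f).ncard := by
  have hfin : X.inner.Finite := hX.subset Set.sdiff_subset
  have hl : X.leftInner f ⊆ X.inner := fun v hv => hv.1
  have hr : X.rightInner f ⊆ X.inner := fun v hv => hv.1
  have hm : X.midInner f ⊆ X.inner := fun v hv => hv.1
  rw [← Set.ncard_union_eq _ (hfin.subset hm) (hfin.subset hl), ← Set.ncard_union_eq _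
    (hfin.subset (Set.union_subset hm hl)) (hfin.subset hr)]
  · congr 1
    ext v
    simp only [Set.mem_union, midInner, Set.mem_ofPred_eq]
    have := @hl v
    have := @hr v
    tauto
  · refine Set.disjoint_left.2 ?_
    rintro v (hv | hv) hv'
    · exact hv.2.2 hv'
    · exact absurd (hv.2.1.trans hv'.2.1) (lt_irrefl _)
  · exact Set.disjoint_left.2 fun v hv hv' => hv.2.1 hv'

end TwoTerminalGraph

/-! ### Counting left and right vertices in a composition -/

open TwoTerminalGraph

/-- Uncrossed left vertices of two different parts would each precede the other. An uncrossed right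
vertex of a part follows a terminal of `Y` lying in another part (`hterm`), so it is not a left
vertex of `Y`. The set `J` takes up the inner vertices of `Y` that are inner in no part. -/
theorem exists_leftInner_le {n : ℕ} (hn : 0 < n) {X : Fin n → TwoTerminalGraph α β}
    {Y : TwoTerminalGraph α β} {f : α → ℤ} (hfin : Y.vertexSet.Finite)
    (hsub : ∀ i, (X i).vertexSet ⊆ Y.vertexSet)
    (hL : ∀ i, ∀ v ∈ (X i).leftInner f, v ∉ crossed f X Y →
      ∀ j ≠ i, ∀ u ∈ (X j).vertexSet, f v < f u)
    (hR : ∀ i, ∀ v ∈ (X i).rightInner f, v ∉ crossed f X Y →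
      ∀ j ≠ i, ∀ u ∈ (X j).vertexSet, f u < f v)
    {J : Set α} (hJ : J.Finite) (hcover : Y.inner ⊆ J ∪ ⋃ i, (X i).inner)
    (hterm : ∀ i, ∃ j ≠ i, Y.source ∈ (X j).vertexSet ∨ Y.sink ∈ (X j).vertexSet) :
    ∃ i, (∀ j ≠ i, (X j).leftInner f ⊆ crossed f X Y) ∧
      (Y.leftInner f).ncard ≤ J.ncard + (∑ j, ((X j).midInner f).ncard) +
        (crossed f X Y).ncard + ((X i).leftInner f \ crossed f X Y).ncard := by
  obtain ⟨i, hi⟩ : ∃ i, ∀ j ≠ i, (X j).leftInner f ⊆ crossed f X Y := by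
    by_contra! hc
    obtain ⟨j, -, hj⟩ := hc ⟨0, hn⟩
    obtain ⟨k, hkj, hk⟩ := hc j
    obtain ⟨v, hv, hvC⟩ := Set.not_subset.1 hj
    obtain ⟨w, hw, hwC⟩ := Set.not_subset.1 hk
    exact lt_irrefl _ ((hL j v hv hvC k hkj w hw.1.1).trans (hL k w hw hwC j hkj.symm v hv.1.1))
  have hCfin : (crossed f X Y).Finite := hfin.subset fun v hv => hv.1
  have hXfin : ∀ i, (X i).vertexSet.Finite := fun i => hfin.subset (hsub i)
  have hMfin : (⋃ j, (X j).midInner f).Finite :=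
    Set.finite_iUnion fun j => (hXfin j).subset fun v hv => hv.1.1
  have hLfin : ((X i).leftInner f \ crossed f X Y).Finite :=
    (hXfin i).subset fun v hv => hv.1.1.1
  refine ⟨i, hi, ?_⟩
  have hM : (⋃ j, (X j).midInner f).ncard ≤ ∑ j, ((X j).midInner f).ncard := by
    simpa using Finset.set_ncard_biUnion_le Finset.univ fun j => (X j).midInner f
  have hsubset : Y.leftInner f ⊆
      ((J ∪ ⋃ j, (X j).midInner f) ∪ crossed f X Y) ∪ ((X i).leftInner f \ crossed f X Y) := by
    rintro v ⟨hv, hvs, hvt⟩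
    by_cases hvC : v ∈ crossed f X Y
    · exact Or.inl (Or.inr hvC)
    rcases hcover hv with hvJ | hvI
    · exact Or.inl (Or.inl (Or.inl hvJ))
    obtain ⟨j, hvj⟩ := Set.mem_iUnion.1 hvI
    by_cases hvl : v ∈ (X j).leftInner f
    · by_cases hij : j = i
      · subst hij; exact Or.inr ⟨hvl, hvC⟩
      · exact absurd (hi j hij hvl) hvC
    by_cases hvr : v ∈ (X j).rightInner f
    · obtain ⟨k, hkj, hk | hk⟩ := hterm j
      · exact absurd ((hR j v hvr hvC k hkj _ hk).trans hvs) (lt_irrefl _)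
      · exact absurd ((hR j v hvr hvC k hkj _ hk).trans hvt) (lt_irrefl _)
    · exact Or.inl (Or.inl (Or.inr (Set.mem_iUnion.2 ⟨j, hvj, hvl, hvr⟩)))
  have h0 := Set.ncard_le_ncard hsubset (((hJ.union hMfin).union hCfin).union hLfin)
  have h1 := Set.ncard_union_le ((J ∪ ⋃ j, (X j).midInner f) ∪ crossed f X Y)
    ((X i).leftInner f \ crossed f X Y)
  have h2 := Set.ncard_union_le (J ∪ ⋃ j, (X j).midInner f) (crossed f X Y)
  have h3 := Set.ncard_union_le J (⋃ j, (X j).midInner f)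
  omega

/-- The common counting argument for series and parallel compositions. -/
theorem sum_ncard_inner_add_max_le {n : ℕ} (hn : 0 < n) {X : Fin n → TwoTerminalGraph α β}
    {Y : TwoTerminalGraph α β} {f : α → ℤ} (hfin : Y.vertexSet.Finite)
    (hsub : ∀ i, (X i).vertexSet ⊆ Y.vertexSet)
    (hdisj : ∀ i j, i ≠ j → Disjoint (X i).inner (X j).inner)
    (hL : ∀ i, ∀ v ∈ (X i).leftInner f, v ∉ crossed f X Y →
      ∀ j ≠ i, ∀ u ∈ (X j).vertexSet, f v < f u)
    (hR : ∀ i, ∀ v ∈ (X i).rightInner f, v ∉ crossed f X Y →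
      ∀ j ≠ i, ∀ u ∈ (X j).vertexSet, f u < f v)
    {J : Set α} (hJ : J.Finite) (hcover : Y.inner ⊆ J ∪ ⋃ i, (X i).inner)
    (hterm : ∀ i, ∃ j ≠ i, Y.source ∈ (X j).vertexSet ∨ Y.sink ∈ (X j).vertexSet)
    {s : ℕ} (hs : ∀ i, (X i).inner.ncard ≤ s) :
    (∑ i, (X i).inner.ncard) + max (Y.leftInner f).ncard (Y.rightInner f).ncard ≤
      s + 2 * (∑ i, ((X i).midInner f).ncard) + 2 * (crossed f X Y).ncard + J.ncard +
        ∑ i, max ((X i).leftInner f).ncard ((X i).rightInner f).ncard := by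
  obtain ⟨iL, hiL, hl⟩ := exists_leftInner_le hn hfin hsub hL hR hJ hcover hterm
  -- Reversing the order exchanges left and right.
  obtain ⟨iR, hiR, hr⟩ := exists_leftInner_le (f := -f) hn hfin hsub
    (by simpa only [leftInner_neg, crossed_neg, Pi.neg_apply, neg_lt_neg_iff] using hR)
    (by simpa only [rightInner_neg, crossed_neg, Pi.neg_apply, neg_lt_neg_iff] using hL)
    hJ hcover hterm
  simp only [leftInner_neg, midInner_neg, crossed_neg] at hiR hr
  set C := crossed f X Y with hC
  have hCfin : C.Finite := hfin.subset fun v hv => hv.1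
  have hXfin : ∀ i, (X i).vertexSet.Finite := fun i => hfin.subset (hsub i)
  have hLfin : ∀ i, ((X i).leftInner f).Finite := fun i => (hXfin i).subset fun v hv => hv.1.1
  have hRfin : ∀ i, ((X i).rightInner f).Finite := fun i => (hXfin i).subset fun v hv => hv.1.1
  have hlsplit : ∀ i, ((X i).leftInner f ∩ C).ncard + ((X i).leftInner f \ C).ncard =
      ((X i).leftInner f).ncard := fun i => Set.ncard_inter_add_ncard_sdiff_eq_ncard _ _ (hLfin i)
  have hrsplit : ∀ i, ((X i).rightInner f ∩ C).ncard + ((X i).rightInner f \ C).ncard =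
      ((X i).rightInner f).ncard := fun i => Set.ncard_inter_add_ncard_sdiff_eq_ncard _ _ (hRfin i)
  have hlu : ∑ i, ((X i).leftInner f \ C).ncard = ((X iL).leftInner f \ C).ncard := by
    refine Finset.sum_eq_single iL (fun j _ hj => ?_) (by simp)
    rw [Set.sdiff_eq_empty.2 (hiL j hj), Set.ncard_empty]
  have hru : ∑ i, ((X i).rightInner f \ C).ncard = ((X iR).rightInner f \ C).ncard := by
    refine Finset.sum_eq_single iR (fun j _ hj => ?_) (by simp)
    rw [Set.sdiff_eq_empty.2 (hiR j hj), Set.ncard_empty]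
  -- The parts have disjoint inner sets, so each crossed vertex is counted at most once.
  have hcov : ∑ i, (((X i).leftInner f ∩ C).ncard + ((X i).rightInner f ∩ C).ncard) ≤
      C.ncard := by
    have h1 : ∀ i, ((X i).leftInner f ∩ C).ncard + ((X i).rightInner f ∩ C).ncard =
        (((X i).leftInner f ∩ C) ∪ ((X i).rightInner f ∩ C)).ncard := by
      intro i
      rw [Set.ncard_union_eq _ (hCfin.subset Set.inter_subset_right)
        (hCfin.subset Set.inter_subset_right)]
      exact Set.disjoint_left.2 fun v hv hv' =>
        absurd (hv.1.2.1.trans hv'.1.2.1) (lt_irrefl _)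
    have hsubC : ∀ i, ((X i).leftInner f ∩ C) ∪ ((X i).rightInner f ∩ C) ⊆ C := fun i =>
      Set.union_subset Set.inter_subset_right Set.inter_subset_right
    rw [Finset.sum_congr rfl fun i _ => h1 i, ← finsum_eq_sum_of_fintype,
      ← Set.ncard_iUnion_of_finite (fun i => hCfin.subset (hsubC i))]
    · exact Set.ncard_le_ncard (Set.iUnion_subset hsubC) hCfin
    · intro i j hij
      refine (hdisj i j hij).mono ?_ ?_ <;>
      · rintro v (hv | hv)
        · exact hv.1.1
        · exact hv.1.1
  have hin : ∑ i, (X i).inner.ncard = (∑ i, ((X i).midInner f).ncard) +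
      (∑ i, (((X i).leftInner f ∩ C).ncard + ((X i).rightInner f ∩ C).ncard)) +
      ((X iL).leftInner f \ C).ncard + ((X iR).rightInner f \ C).ncard := by
    rw [← hlu, ← hru, ← Finset.sum_add_distrib, ← Finset.sum_add_distrib,
      ← Finset.sum_add_distrib]
    refine Finset.sum_congr rfl fun i _ => ?_
    rw [ncard_inner f (hXfin i), ← hlsplit, ← hrsplit]
    ring
  have hsL := hs iL
  have hsR := hs iR
  rw [ncard_inner f (hXfin _)] at hsL hsR
  have h1 := hlsplit iL
  have h2 := hrsplit iR
  have h3 := hrsplit iL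
  -- Let `a` and `b` be the numbers of uncrossed left and right vertices; `a + b + max a b` has to
  -- be bounded. If the parts coincide, `a + b ≤ s` and `max a b` is charged to that part. Otherwise
  -- `max a b ≤ s`, while `a` and `b` are charged to different parts.
  by_cases hLR : iL = iR
  · subst hLR
    have := Finset.single_le_sum (f := fun i =>
      max ((X i).leftInner f).ncard ((X i).rightInner f).ncard) (fun _ _ => Nat.zero_le _)
      (Finset.mem_univ iL)
    omega
  · have := Finset.sum_le_sum_of_subset (f := fun i =>
      max ((X i).leftInner f).ncard ((X i).rightInner f).ncard)
      (Finset.subset_univ {iL, iR})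
    rw [Finset.sum_pair hLR] at this
    omega

theorem not_crosses_of_notMem_crossed {n : ℕ} {X : Fin n → TwoTerminalGraph α β}
    {Y : TwoTerminalGraph α β} {f : α → ℤ} {v : α} (hv : v ∈ Y.vertexSet)
    (hc : v ∉ crossed f X Y) {i : Fin n} (hi : v ∉ (X i).vertexSet) :
    ¬ Crosses f (X i).toGraph v :=
  fun h => hc ⟨hv, i, hi, h⟩

/-- A component that does not cross `v` and has a vertex after `v` lies after `v`. -/
theorem IsEdgeDisjointUnion.lt_of_lt {n : ℕ} {X : Fin n → TwoTerminalGraph α β}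
    {Y : TwoTerminalGraph α β} (h : IsEdgeDisjointUnion X Y)
    (hX : ∀ i, IsConnected (X i).toGraph) {f : α → ℤ} (hf : Set.InjOn f Y.vertexSet) {v : α}
    (hv : v ∈ Y.vertexSet) (hc : v ∉ crossed f X Y) {i : Fin n} (hi : v ∉ (X i).vertexSet)
    {u w : α} (hw : w ∈ (X i).vertexSet) (hvw : f v < f w) (hu : u ∈ (X i).vertexSet) :
    f v < f u := by
  have hne : ∀ x ∈ (X i).vertexSet, f x ≠ f v := fun x hx hxv =>
    hi (hf (h.mem_vertexSet hx) hv hxv ▸ hx)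
  by_contra hlt
  exact not_crosses_of_notMem_crossed hv hc hi
    ((hX i).crosses hne hu hw (lt_of_le_of_ne (not_lt.1 hlt) (hne u hu)) hvw)

/-! ### Parallel compositions -/

theorem IsParallelComposition.notMem {n : ℕ} {X : Fin n → TwoTerminalGraph α β}
    {Y : TwoTerminalGraph α β} (h : IsParallelComposition X Y) {i j : Fin n} (hij : i ≠ j)
    {v : α} (hv : v ∈ (X i).inner) : v ∉ (X j).vertexSet := by
  intro hj
  have : v ∈ (X i).vertexSet ∩ (X j).vertexSet := ⟨hv.1, hj⟩
  rw [h.inter_eq i j hij, ← h.source_eq i, ← h.sink_eq i] at this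
  exact hv.2 this

theorem IsParallelComposition.inner_eq {n : ℕ} {X : Fin n → TwoTerminalGraph α β}
    {Y : TwoTerminalGraph α β} (h : IsParallelComposition X Y) :
    Y.inner = ⋃ i, (X i).inner := by
  ext v
  simp only [TwoTerminalGraph.inner, h.isUnion.vertexSet_eq, Set.mem_sdiff, Set.mem_iUnion, h.source_eq, h.sink_eq]
  grind

/-- The other part contains the common source, which lies after `v`. -/
theorem IsParallelComposition.lt_of_mem_leftInner {n : ℕ} {X : Fin n → TwoTerminalGraph α β}
    {Y : TwoTerminalGraph α β} (h : IsParallelComposition X Y)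
    (hX : ∀ i, IsConnected (X i).toGraph) {f : α → ℤ} (hf : Set.InjOn f Y.vertexSet)
    (i : Fin n) (v : α) (hv : v ∈ (X i).leftInner f) (hc : v ∉ crossed f X Y) (j : Fin n)
    (hj : j ≠ i) (u : α) (hu : u ∈ (X j).vertexSet) : f v < f u := by
  refine h.isUnion.lt_of_lt hX hf (h.isUnion.mem_vertexSet hv.1.1) hc
    (h.notMem hj.symm hv.1) (X j).source_mem ?_ hu
  rw [h.source_eq, ← h.source_eq i]
  exact hv.2.1

theorem injOn_neg {f : α → ℤ} {s : Set α} (hf : Set.InjOn f s) : Set.InjOn (-f) s :=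
  fun _ hx _ hy h => hf hx hy (neg_injective h)

theorem exists_ne_fin {n : ℕ} (hn : 2 ≤ n) (i : Fin n) : ∃ j, j ≠ i := by
  have : Nontrivial (Fin n) := Fin.nontrivial_iff_two_le.2 hn
  exact exists_ne i

/-- Such a vertex lies between the common terminals, and any other part connects these. -/
theorem IsParallelComposition.midInner_subset {n : ℕ} {X : Fin n → TwoTerminalGraph α β}
    {Y : TwoTerminalGraph α β} (h : IsParallelComposition X Y)
    (hX : ∀ i, IsConnected (X i).toGraph) {f : α → ℤ} (hf : Set.InjOn f Y.vertexSet)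
    (i : Fin n) : (X i).midInner f ⊆ crossed f X Y := by
  rintro v ⟨hv, hvl, hvr⟩
  obtain ⟨j, hj⟩ := exists_ne_fin h.two_le i
  have hvY := h.isUnion.mem_vertexSet hv.1
  have hvj := h.notMem hj.symm hv
  refine ⟨hvY, j, hvj, ?_⟩
  have hne : ∀ x ∈ (X j).vertexSet, f x ≠ f v := fun x hx hxv =>
    hvj (hf (h.isUnion.mem_vertexSet hx) hvY hxv ▸ hx)
  have h1 := hne _ (X j).source_mem
  have h2 := hne _ (X j).sink_mem
  simp only [leftInner, rightInner, Set.mem_ofPred_eq, hv, true_and, h.source_eq,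
    h.sink_eq] at hvl hvr h1 h2
  have hs : Y.source ∈ (X j).vertexSet := h.source_eq j ▸ (X j).source_mem
  have ht : Y.sink ∈ (X j).vertexSet := h.sink_eq j ▸ (X j).sink_mem
  rcases lt_or_gt_of_ne h1 with h1 | h1
  · exact (hX j).crosses hne hs ht h1 (by by_contra; exact hvr ⟨h1, by omega⟩)
  · exact (hX j).crosses hne ht hs (by by_contra; exact hvl ⟨h1, by omega⟩) h1

/-- The coefficient 6 consists of 2 from the common counting, 2 for the middle vertices of the parts
and 2 for those of `Y`, all of which are crossed. -/
theorem IsParallelComposition.sum_add_le {n : ℕ} {X : Fin n → TwoTerminalGraph α β}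
    {Y : TwoTerminalGraph α β} (h : IsParallelComposition X Y)
    (hX : ∀ i, IsNice (X i).toGraph) {f : α → ℤ} (hf : Set.InjOn f Y.vertexSet)
    {s : ℕ} (hs : ∀ i, (X i).inner.ncard ≤ s) :
    (∑ i, (X i).inner.ncard) + 2 * (Y.midInner f).ncard +
        max (Y.leftInner f).ncard (Y.rightInner f).ncard ≤
      s + 6 * (crossed f X Y).ncard +
        ∑ i, max ((X i).leftInner f).ncard ((X i).rightInner f).ncard := by
  have hconn := fun i => (hX i).isConnected
  have hY := h.isUnion.isNice hX (h.isConnected hconn)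
  have hCfin : (crossed f X Y).Finite := hY.finite_vertexSet.subset fun v hv => hv.1
  have h2 := h.two_le
  have hM : ∑ i, ((X i).midInner f).ncard ≤ (crossed f X Y).ncard := by
    rw [← finsum_eq_sum_of_fintype, ← Set.ncard_iUnion_of_finite]
    · exact Set.ncard_le_ncard (Set.iUnion_subset fun i => h.midInner_subset hconn hf i) hCfin
    · exact fun i => hCfin.subset (h.midInner_subset hconn hf i)
    · exact fun i j hij => Set.disjoint_left.2 fun v hi hj => h.notMem hij hi.1 hj.1.1
  have hMY : (Y.midInner f).ncard ≤ (crossed f X Y).ncard := by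
    refine Set.ncard_le_ncard ?_ hCfin
    rintro v ⟨hv, hvl, hvr⟩
    have hv' := hv
    rw [h.inner_eq] at hv'
    obtain ⟨i, hi⟩ := Set.mem_iUnion.1 hv'
    refine h.midInner_subset hconn hf i ⟨hi, ?_, ?_⟩
    · rintro ⟨-, h3⟩
      rw [h.source_eq, h.sink_eq] at h3
      exact hvl ⟨hv, h3⟩
    · rintro ⟨-, h3⟩
      rw [h.source_eq, h.sink_eq] at h3
      exact hvr ⟨hv, h3⟩
  have := sum_ncard_inner_add_max_le (X := X) (J := ∅) (f := f) (by omega) hY.finite_vertexSet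
    (fun i v hv => h.isUnion.mem_vertexSet hv)
    (fun i j hij => Set.disjoint_left.2 fun v hi hj => h.notMem hij hi hj.1)
    (h.lt_of_mem_leftInner hconn hf)
    (by simpa only [leftInner_neg, crossed_neg, Pi.neg_apply, neg_lt_neg_iff] using
      h.lt_of_mem_leftInner hconn (injOn_neg hf))
    Set.finite_empty (by rw [h.inner_eq]; exact Set.subset_union_right)
    (fun i => by
      obtain ⟨j, hj⟩ := exists_ne_fin h2 i
      exact ⟨j, hj, Or.inl (h.source_eq j ▸ (X j).source_mem)⟩) hs
  rw [Set.ncard_empty] at this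
  omega

/-! ### Series compositions -/

theorem IsSeriesComposition.notMem {n : ℕ} {X : Fin n → TwoTerminalGraph α β}
    {Y : TwoTerminalGraph α β} (h : IsSeriesComposition X Y) {i j : Fin n} (hij : i ≠ j)
    {v : α} (hv : v ∈ (X i).inner) : v ∉ (X j).vertexSet := by
  intro hj
  have hij' : (i : ℕ) ≠ j := fun h => hij (Fin.ext h)
  rcases lt_or_gt_of_ne hij' with hlt | hlt
  · rcases eq_or_lt_of_le (Nat.succ_le_of_lt hlt) with heq | hlt
    · have : v ∈ (X i).vertexSet ∩ (X j).vertexSet := ⟨hv.1, hj⟩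
      rw [h.inter_eq i j heq] at this
      exact hv.2 (Or.inr this)
    · exact Set.disjoint_left.1 (h.disjoint i j hlt) hv.1 hj
  · rcases eq_or_lt_of_le (Nat.succ_le_of_lt hlt) with heq | hlt
    · have : v ∈ (X j).vertexSet ∩ (X i).vertexSet := ⟨hj, hv.1⟩
      rw [h.inter_eq j i heq, h.sink_eq_source j i heq] at this
      exact hv.2 (Or.inl this)
    · exact Set.disjoint_left.1 (h.disjoint j i hlt) hj hv.1

/-- Both neighbours of `X i` in the chain contain one of its terminals, which lies after `v`. An
uncrossed part with one vertex after `v` lies entirely after `v`, so the property spreads along the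
chain through the merged terminals, in both directions. -/
theorem IsSeriesComposition.lt_of_mem_leftInner {n : ℕ} {X : Fin n → TwoTerminalGraph α β}
    {Y : TwoTerminalGraph α β} (h : IsSeriesComposition X Y)
    (hX : ∀ i, IsConnected (X i).toGraph) {f : α → ℤ} (hf : Set.InjOn f Y.vertexSet)
    (i : Fin n) (v : α) (hv : v ∈ (X i).leftInner f) (hc : v ∉ crossed f X Y) (j : Fin n)
    (hj : j ≠ i) (u : α) (hu : u ∈ (X j).vertexSet) : f v < f u := by
  have step : ∀ k ≠ i, ∀ w ∈ (X k).vertexSet, f v < f w → ∀ u ∈ (X k).vertexSet, f v < f u :=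
    fun k hk w hw hvw u hu => h.isUnion.lt_of_lt hX hf (h.isUnion.mem_vertexSet hv.1.1) hc
      (h.notMem hk.symm hv.1) hw hvw hu
  have up : ∀ d, ∀ k : Fin n, (k : ℕ) = i + 1 + d → ∀ u ∈ (X k).vertexSet, f v < f u := by
    intro d
    induction d with
    | zero =>
      intro k hk
      refine step k (fun hki => by subst hki; omega) _ (X k).source_mem ?_
      rw [← h.sink_eq_source i k (by omega)]
      exact hv.2.2
    | succ d ih =>
      intro k hk
      refine step k (fun hki => by subst hki; omega) _ (X k).source_mem ?_
      rw [← h.sink_eq_source ⟨k - 1, by omega⟩ k (by simp only; omega)]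
      exact ih _ (by simp only; omega) _ (X _).sink_mem
  have down : ∀ d, ∀ k : Fin n, (k : ℕ) + 1 + d = i → ∀ u ∈ (X k).vertexSet, f v < f u := by
    intro d
    induction d with
    | zero =>
      intro k hk
      refine step k (fun hki => by subst hki; omega) _ (X k).sink_mem ?_
      rw [h.sink_eq_source k i (by omega)]
      exact hv.2.1
    | succ d ih =>
      intro k hk
      refine step k (fun hki => by subst hki; omega) _ (X k).sink_mem ?_
      rw [h.sink_eq_source k ⟨k + 1, by omega⟩ rfl]
      exact ih _ (by simp only; omega) _ (X _).source_mem
  have hij' : (i : ℕ) ≠ j := fun h => hj (Fin.ext h.symm)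
  rcases lt_or_gt_of_ne hij' with hlt | hlt
  · exact up (j - (i + 1)) j (by omega) u hu
  · exact down (i - (j + 1)) j (by omega) u hu

theorem IsSeriesComposition.sum_add_le {n : ℕ} {X : Fin n → TwoTerminalGraph α β}
    {Y : TwoTerminalGraph α β} (h : IsSeriesComposition X Y)
    (hX : ∀ i, IsNice (X i).toGraph) {f : α → ℤ} (hf : Set.InjOn f Y.vertexSet)
    {s : ℕ} (hs : ∀ i, (X i).inner.ncard ≤ s) :
    (∑ i, (X i).inner.ncard) + max (Y.leftInner f).ncard (Y.rightInner f).ncard ≤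
      s + 2 * (∑ i, ((X i).midInner f).ncard) + 2 * (crossed f X Y).ncard + (n - 1) +
        ∑ i, max ((X i).leftInner f).ncard ((X i).rightInner f).ncard := by
  have hconn := fun i => (hX i).isConnected
  have hY := h.isUnion.isNice hX (h.isConnected hconn)
  have h2 := h.two_le
  let first : Fin n := ⟨0, by omega⟩
  let last : Fin n := ⟨n - 1, by omega⟩
  have hlast : ((last : Fin n) : ℕ) + 1 = n := by simp only [last]; omega
  -- The `n - 1` merged terminals are inner in `Y` but in no part.
  let J : Set α := (fun i => (X i).sink) '' ((Finset.univ.erase last : Finset (Fin n)) : Set (Fin n))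
  have hJfin : J.Finite := (Finset.finite_toSet _).image _
  have hJ : J.ncard ≤ n - 1 := by
    refine (Set.ncard_image_le (Finset.finite_toSet _)).trans ?_
    rw [Set.ncard_coe_finset, Finset.card_erase_of_mem (Finset.mem_univ _)]
    simp
  have hcover : Y.inner ⊆ J ∪ ⋃ i, (X i).inner := by
    rintro v ⟨hv, hvt⟩
    rw [h.isUnion.vertexSet_eq] at hv
    obtain ⟨i, hi⟩ := Set.mem_iUnion.1 hv
    have sink_mem : ∀ k, v = (X k).sink → v ∈ J := by
      intro k hk
      refine ⟨k, ?_, hk.symm⟩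
      simp only [Finset.coe_erase, Finset.coe_univ, Set.mem_sdiff, Set.mem_univ, true_and,
        Set.mem_singleton_iff]
      rintro rfl
      exact hvt (Or.inr (hk.trans (h.sink_eq _ hlast).symm))
    by_cases hs : v = (X i).source
    · by_cases hi0 : (i : ℕ) = 0
      · exact absurd (Or.inl (hs.trans (h.source_eq i hi0).symm)) hvt
      · refine Or.inl (sink_mem ⟨i - 1, by omega⟩ ?_)
        rw [hs, h.sink_eq_source ⟨i - 1, by omega⟩ i (by simp only; omega)]
    by_cases ht : v = (X i).sink
    · exact Or.inl (sink_mem i ht)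
    · refine Or.inr (Set.mem_iUnion.2 ⟨i, hi, ?_⟩)
      rintro (hv | hv)
      · exact hs hv
      · exact ht hv
  have := sum_ncard_inner_add_max_le (X := X) (J := J) (f := f) (by omega) hY.finite_vertexSet
    (fun i v hv => h.isUnion.mem_vertexSet hv)
    (fun i j hij => Set.disjoint_left.2 fun v hi hj => h.notMem hij hi hj.1)
    (h.lt_of_mem_leftInner hconn hf)
    (by simpa only [leftInner_neg, crossed_neg, Pi.neg_apply, neg_lt_neg_iff] using
      h.lt_of_mem_leftInner hconn (injOn_neg hf))
    hJfin hcover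
    (fun i => by
      by_cases hi : i = first
      · refine ⟨last, fun hl => ?_, Or.inr (h.sink_eq last hlast ▸ (X last).sink_mem)⟩
        have := congrArg Fin.val (hl.trans hi)
        simp only [first, last] at this
        omega
      · exact ⟨first, fun hf => hi hf.symm,
          Or.inl (h.source_eq first rfl ▸ (X first).source_mem)⟩) hs
  omega

/-! ### The bound along an SP-tree -/

namespace SPTree

open Classical in
/-- The contribution of a single node to the lower bound. -/
noncomputable def nodeWeight (C : SPTree α β) : ℤ :=
  (if C.IsLNode then 2 * ((C.card : ℤ) - 1) else 0)
    + (if C.IsPNode then C.sumSubMax cardNoTerminals else 0)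
    + (if C.IsSNode ∨ C.IsLNode then C.sumSubMax cardNoSink else 0)

/-- The sum of the contributions of all nodes. -/
noncomputable def weight (T : SPTree α β) : ℤ := (T.nodes.map nodeWeight).sum

theorem sum_map_filter_eq {γ : Type*} (p : γ → Prop) [DecidablePred p] (g : γ → ℤ)
    (s : Multiset γ) :
    ((s.filter p).map g).sum = (s.map fun x => if p x then g x else 0).sum := by
  induction s using Multiset.induction with
  | empty => simp
  | cons a s ih => by_cases h : p a <;> simp [h, ih]

theorem weight_eq (T : SPTree α β) :
    T.weight = (T.simpleNodeSequences.map fun L => 2 * ((L.card : ℤ) - 1)).sum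
      + (T.parallelComponents.map fun P => P.sumSubMax cardNoTerminals).sum
      + (T.seriesComponents.map fun S => S.sumSubMax cardNoSink).sum := by
  classical
  simp only [weight, simpleNodeSequences, parallelComponents, seriesComponents,
    sum_map_filter_eq, ← Multiset.sum_map_add]
  rfl

theorem sum_map_nodes {n : ℕ} (child : Fin n → SPTree α β) :
    ((∑ i, (child i).nodes).map nodeWeight).sum = ∑ i, (child i).weight := by
  simp only [← Multiset.coe_mapAddMonoidHom, map_sum, ← Multiset.coe_sumAddMonoidHom]
  rfl

theorem weight_L {k : ℕ} {X : TwoTerminalGraph α β} (h : IsPathGraph k X) :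
    (L k X).weight = 2 * k := by
  simp [weight, nodes, nodeWeight, IsLNode, IsPNode, IsSNode, sumSubMax, children, card, graph,
    h.vertexSet_ncard]

theorem weight_S {n : ℕ} (X : TwoTerminalGraph α β) (child : Fin n → SPTree α β) :
    (S X child).weight = (S X child).sumSubMax cardNoSink + ∑ i, (child i).weight := by
  rw [← sum_map_nodes]
  simp [weight, nodes, nodeWeight, IsLNode, IsPNode, IsSNode]

theorem weight_P {n : ℕ} (X : TwoTerminalGraph α β) (child : Fin n → SPTree α β) :
    (P X child).weight = (P X child).sumSubMax cardNoTerminals + ∑ i, (child i).weight := by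
  rw [← sum_map_nodes]
  simp [weight, nodes, nodeWeight, IsLNode, IsPNode, IsSNode]

theorem cardNoSink_eq {T : SPTree α β} (hT : T.graph.vertexSet.Finite) :
    T.cardNoSink = T.graph.inner.ncard + 1 := by
  have : T.graph.vertexSet \ {T.graph.sink} = insert T.graph.source T.graph.inner := by
    ext v
    have h1 := T.graph.source_mem
    have h2 := T.graph.source_ne_sink
    simp only [TwoTerminalGraph.inner, Set.mem_sdiff, Set.mem_singleton_iff, Set.mem_insert_iff]
    grind
  rw [cardNoSink, this, Set.ncard_insert_of_notMem (fun h => h.2 (Or.inl rfl))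
    (hT.subset fun v hv => hv.1)]

/-- The lower bound with the positions of the terminals taken into account. -/
theorem IsConsistent.weight_add_le {T : SPTree α β} (hT : T.IsConsistent) (hmin : T.IsMinimal)
    {f : α → ℤ} (hf : Set.InjOn f T.graph.vertexSet) :
    T.weight + (max (T.graph.leftInner f).ncard (T.graph.rightInner f).ncard : ℕ) + 2 ≤
        7 * rankCost f T.graph.toGraph ∧
      (¬ T.IsSNode → T.weight + 2 * (T.graph.midInner f).ncard +
        (max (T.graph.leftInner f).ncard (T.graph.rightInner f).ncard : ℕ) + 2 ≤
        7 * rankCost f T.graph.toGraph) := by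
  induction T with
  | L k X =>
    have hX : IsPathGraph k X := hT
    have hfin := hX.isNice.finite_vertexSet
    have h1 := ncard_inner f hfin
    have h2 : X.inner.ncard + 2 = k + 1 := by
      rw [← hX.vertexSet_ncard, TwoTerminalGraph.inner, ← Set.ncard_pair X.source_ne_sink]
      refine Set.ncard_sdiff_add_ncard_of_subset ?_ hfin
      rintro v (rfl | rfl)
      · exact X.source_mem
      · exact X.sink_mem
    have h3 : k ≤ rankCost f X.toGraph := by
      rw [rankCost, hX.edgeSet_eq.1]; omega
    -- The left side is at most `2 * k + 2 * (k - 1) + 2 = 4 * k`, and there are `k` edges.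
    simp only [weight_L hX, graph]
    omega
  | @S X n child ih =>
    obtain ⟨h, hc⟩ := hT
    obtain ⟨hkind, -, hm⟩ := hmin
    have hnice := fun i => (hc i).isNice
    have hsubset : ∀ i, (child i).graph.vertexSet ⊆ X.vertexSet := fun i v hv =>
      h.isUnion.mem_vertexSet (i := i) hv
    -- Minimality enters here: no child is an `S`-node, so the stronger inequality is available.
    have hih : ∀ i, (child i).weight + 2 * ((child i).graph.midInner f).ncard +
        (max ((child i).graph.leftInner f).ncard ((child i).graph.rightInner f).ncard : ℕ) + 2 ≤
        7 * rankCost f (child i).graph.toGraph := by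
      intro i
      refine (ih i (hc i) (hm i) (hf.mono (hsubset i))).2 ?_
      rcases hi : child i <;> have := hkind i <;> simp_all [IsPNode, IsLNode, IsSNode]
    refine ⟨?_, fun hS => absurd trivial hS⟩
    simp only [weight_S, graph]
    have hsum := Finset.sum_le_sum fun i (_ : i ∈ Finset.univ) => hih i
    simp only [Finset.sum_add_distrib, ← Finset.mul_sum, ← Nat.cast_sum, Finset.sum_const,
      Finset.card_univ, Fintype.card_fin, nsmul_eq_mul] at hsum
    have hrank := h.isUnion.rankCost_ge
      (h.isUnion.isNice hnice (h.isConnected fun i => (hnice i).isConnected)) hnice f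
    set M := ((S X child).children.map cardNoSink).sup with hM
    have hle : ∀ i, (child i).graph.inner.ncard + 1 ≤ M := by
      intro i
      rw [← cardNoSink_eq (hnice i).finite_vertexSet]
      exact Multiset.le_sup (Multiset.mem_map_of_mem _
        (Multiset.mem_map_of_mem child (Finset.mem_univ_val i)))
    have hsize : (((S X child).children.map cardNoSink).sum) =
        (∑ i, (child i).graph.inner.ncard) + n := by
      simp only [children, Multiset.map_map]
      change ∑ i, (child i).cardNoSink = _
      simp [cardNoSink_eq (hnice _).finite_vertexSet, Finset.sum_add_distrib]
    -- `M` counts the source of a child as well as its inner vertices, hence `M - 1`.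
    have key := h.sum_add_le hnice hf (s := M - 1) fun i => by have := hle i; omega
    have h2 := h.two_le
    have hM1 := hle ⟨0, by omega⟩
    rw [sumSubMax, hsize, ← hM]
    -- The `n` sources, the `n - 1` merged terminals, the `-1` from `M - 1` and the additive 2 total
    -- `2 * n`, exactly the sum of the children's constants.
    omega
  | P X child ih =>
    obtain ⟨h, hc⟩ := hT
    obtain ⟨-, hm⟩ := hmin
    have hnice := fun i => (hc i).isNice
    have hsubset : ∀ i, (child i).graph.vertexSet ⊆ X.vertexSet := fun i v hv =>
      h.isUnion.mem_vertexSet (i := i) hv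
    have hih := fun i => (ih i (hc i) (hm i) (hf.mono (hsubset i))).1
    simp only [weight_P, graph]
    have hsum := Finset.sum_le_sum fun i (_ : i ∈ Finset.univ) => hih i
    simp only [Finset.sum_add_distrib, ← Finset.mul_sum, ← Nat.cast_sum, Finset.sum_const,
      Finset.card_univ, Fintype.card_fin, nsmul_eq_mul] at hsum
    have hrank := h.isUnion.rankCost_ge
      (h.isUnion.isNice hnice (h.isConnected fun i => (hnice i).isConnected)) hnice f
    set M := ((P X child).children.map cardNoTerminals).sup with hM
    have hle : ∀ i, (child i).graph.inner.ncard ≤ M := by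
      intro i
      exact Multiset.le_sup (Multiset.mem_map_of_mem cardNoTerminals
        (Multiset.mem_map_of_mem child (Finset.mem_univ_val i)))
    have hsize : (((P X child).children.map cardNoTerminals).sum) =
        ∑ i, (child i).graph.inner.ncard := by
      simp only [children, Multiset.map_map]
      rfl
    -- This bound includes `2 * mid` for the composition itself, so it yields both inequalities from
    -- the weaker one of the children.
    have key := h.sum_add_le hnice hf hle
    have h2 := h.two_le
    rw [sumSubMax, hsize, ← hM]
    omega

end SPTree

end SeriesParallel

theorem mainTheorem2 {α β : Type*} (G : Graph α β) (hG : SeriesParallel.IsSeriesParallel G)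
    (T : SeriesParallel.SPTree α β) (hT : T.IsSPTreeOf G) (hmin : T.IsMinimal)
    (π : α → ℕ) (hπ : SeriesParallel.IsOptimalArrangement G π) :
    7 * SeriesParallel.cost G π ≥
      (T.simpleNodeSequences.map fun L => 2 * ((L.card : ℤ) - 1)).sum
      + (T.parallelComponents.map fun P =>
          P.sumSubMax SeriesParallel.SPTree.cardNoTerminals).sum
      + (T.seriesComponents.map fun S =>
          S.sumSubMax SeriesParallel.SPTree.cardNoSink).sum := by
  obtain ⟨hc, rfl⟩ := hT
  have hinj : Set.InjOn π T.graph.vertexSet := hπ.1.injOn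
  have h1 := hc.isNice.rankCost_le_cost hinj
  have h2 := (hc.weight_add_le hmin (f := fun v => (π v : ℤ))
    fun x hx y hy h => hinj hx hy (by simpa using h)).1
  rw [SeriesParallel.SPTree.weight_eq] at h2
  omega
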